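/- For $m\ge 1$ let $P_m\subset\mathbb{R}^m$ be the permutohedron, i.e. the convex hull of the points $(\sigma^{-1}(1),\dots,\sigma^{-1}(m))$, $\sigma\in S_m$, and for $k\ge 0$ let $\Delta^k$ be the standard $k$-simplex with vertices $v_1,\dots,v_{k+1}$; write $\partial_i\Delta^k=v_1\cdots\widehat{v_i}\cdots v_{k+1}$ for the facet spanned by all the vertices except $v_i$. Let $n\ge 3$, $k\ge 2$ and $m_1,\dots,m_k\ge 1$ be integers with $m_1+\cdots+m_k=n-1$, and put $$X=P_{m_1}\times\cdots\times P_{m_k}\times\Delta^k,\qquad Y=P_{m_1}\times\cdots\times P_{m_k}\times\bigcup_{i=2}^{k}\partial_i\Delta^k .$$ Let $\partial X$ be the boundary of the polytope $X$ (relative to its affine span), and let $\operatorname{Int}(Y)$ be the interior of $Y$ as a subspace of $\partial X$. Then $A=\partial X\setminus\operatorname{Int}(Y)$ is a (strong) deformation retract of $X$: there is a continuous map $H\colon X\times[0,1]\to X$ such that $H(x,0)=x$ and $H(x,1)\in A$ for all $x\in X$, and $H(a,t)=a$ for all $a\in A$ and $t\in[0,1]$. -/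

import Mathlib

/-- The vertex `v_σ = (σ⁻¹(1), …, σ⁻¹(n))` of the permutohedron (values shifted from
`{0, …, n-1}` to `{1, …, n}`). -/
def permVertex (n : ℕ) (σ : Equiv.Perm (Fin n)) : Fin n → ℝ :=
  fun i => ((σ⁻¹ i : Fin n) : ℕ) + 1

/-- The permutohedron `P_n ⊆ ℝⁿ`. -/
def permutohedron (n : ℕ) : Set (Fin n → ℝ) :=
  convexHull ℝ (Set.range (permVertex n))

/-- The facet `v_1 ⋯ v̂_i ⋯ v_{k+1}` of the standard simplex `Δ^k = v_1 ⋯ v_{k+1}`: the convex hull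
of all the vertices other than the `i`-th one. Vertices are indexed from `0`. -/
def simplexFacet (k : ℕ) (i : Fin (k + 1)) : Set (Fin (k + 1) → ℝ) :=
  convexHull ℝ ((fun j : Fin (k + 1) => (Pi.single j 1 : Fin (k + 1) → ℝ)) '' {j | j ≠ i})

/-- The union of the facets of `Δ^k` opposite to all the vertices except the first and the last. -/
def innerFacets (k : ℕ) : Set (Fin (k + 1) → ℝ) :=
  ⋃ (i : Fin (k + 1)) (_ : i ≠ 0 ∧ i ≠ Fin.last k), simplexFacet k i

/-- The ambient space `ℝ^{m_1} × ⋯ × ℝ^{m_k} × ℝ^{k+1}`. -/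
abbrev CellAmbient {k : ℕ} (m : Fin k → ℕ) : Type :=
  ((l : Fin k) → Fin (m l) → ℝ) × (Fin (k + 1) → ℝ)

/-- The cell `P_{m_1} × ⋯ × P_{m_k} × Δ^k`. -/
def productCell {k : ℕ} (m : Fin k → ℕ) : Set (CellAmbient m) :=
  (Set.univ.pi fun l => permutohedron (m l)) ×ˢ stdSimplex ℝ (Fin (k + 1))

/-- The part `P_{m_1} × ⋯ × P_{m_k} × ⋃_{i=2}^k v_1 ⋯ v̂_i ⋯ v_{k+1}` of the boundary of the cell. -/
def gluedPart {k : ℕ} (m : Fin k → ℕ) : Set (CellAmbient m) :=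
  (Set.univ.pi fun l => permutohedron (m l)) ×ˢ innerFacets k

/-- The boundary of a convex polytope, taken in its affine span. -/
def polytopeBoundary {k : ℕ} {m : Fin k → ℕ} (X : Set (CellAmbient m)) : Set (CellAmbient m) :=
  intrinsicFrontier ℝ X

/-- The interior of `Y ∩ B` in the subspace `B`, as a subset of the ambient space. -/
def interiorIn {E : Type*} [TopologicalSpace E] (B Y : Set E) : Set E :=
  Subtype.val '' interior (Subtype.val ⁻¹' Y : Set B)

/-- `A` is a (strong) deformation retract of `X`: there is a homotopy of `X`, starting at the
identity, fixing every point of `A` at all times, and ending in a map of `X` into `A`. -/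
def IsDeformationRetract {E : Type*} [TopologicalSpace E] (A X : Set E) : Prop :=
  A ⊆ X ∧ ∃ H : C(X × unitInterval, X),
    (∀ x, H (x, 0) = x) ∧ (∀ x, (H (x, 1) : E) ∈ A) ∧
      ∀ (x : X) (t : unitInterval), (x : E) ∈ A → H (x, t) = x

/-!
A point `c` of the hyperplane `∑ sᵢ = 1` whose barycentric coordinates are negative exactly on `I`
lies beyond the facets `∂ᵢΔ`, `i ∈ I`, and on the inner side of the others. A ray from `(p, c)`,
with `p` in the relative interior of `P`, therefore leaves `P × Δ` through
`∂P × Δ ∪ P × ⋃_{i ∉ I} ∂ᵢΔ`, and the exit point depends continuously on the ray because it is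
given by the Minkowski functional of the convex set `Q` obtained from `P × Δ` by forgetting the
constraints `sᵢ ≥ 0`, `i ∈ I`. Pushing along these rays is the deformation retraction. On the other
hand `∂P × Δ ∪ P × ⋃_{i ∉ I} ∂ᵢΔ` is the closure of the complement of `Y = P × ⋃_{i ∈ I} ∂ᵢΔ` in
the boundary, because moving the simplex coordinate towards the barycentre of the face spanned by
`I` takes any of its points off `Y`.
-/

open Set Topology

section IntrinsicInterior

variable {𝕜 V P : Type*} [Ring 𝕜] [AddCommGroup V] [Module 𝕜 V] [TopologicalSpace P]
  [AddTorsor V P] {s : Set P} {x : P}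

theorem mem_intrinsicInterior_iff_mem_nhdsWithin :
    x ∈ intrinsicInterior 𝕜 s ↔ x ∈ s ∧ s ∈ 𝓝[affineSpan 𝕜 s] x := by
  refine ⟨fun hx => ⟨intrinsicInterior_subset hx, ?_⟩, fun ⟨hxs, hs⟩ => ?_⟩
  · obtain ⟨y, hy, rfl⟩ := mem_intrinsicInterior.1 hx
    exact preimage_coe_mem_nhds_subtype.1 (mem_interior_iff_mem_nhds.1 hy)
  · exact ⟨⟨x, subset_affineSpan 𝕜 s hxs⟩,
      mem_interior_iff_mem_nhds.2 (preimage_coe_mem_nhds_subtype.2 hs), rfl⟩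

theorem mem_intrinsicInterior_of_inter_subset {S : AffineSubspace 𝕜 P} {U : Set P} (hsS : s ⊆ S)
    (hU : IsOpen U) (hUs : U ∩ S ⊆ s) (hxU : x ∈ U) (hxS : x ∈ S) : x ∈ intrinsicInterior 𝕜 s :=
  mem_intrinsicInterior_iff_mem_nhdsWithin.2 ⟨hUs ⟨hxU, hxS⟩,
    nhdsWithin_mono x (affineSpan_le.2 hsS) <|
      Filter.mem_of_superset (inter_comm U S ▸ inter_mem_nhdsWithin _ (hU.mem_nhds hxU)) hUs⟩

theorem intrinsicFrontier_eq_sdiff_of_isClosed (hs : IsClosed s) :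
    intrinsicFrontier 𝕜 s = s \ intrinsicInterior 𝕜 s := by
  have hclosure : intrinsicClosure 𝕜 s = s := by
    rw [intrinsicClosure_eq_closure_inter_affineSpan, hs.closure_eq,
      inter_eq_left.2 (subset_affineSpan 𝕜 s)]
  rw [← intrinsicClosure_sdiff_intrinsicInterior, hclosure]

theorem intrinsicFrontier_prod_of_isClosed {W R : Type*} [AddCommGroup W] [Module 𝕜 W]
    [TopologicalSpace R] [AddTorsor W R] {t : Set R} (hs : IsClosed s) (ht : IsClosed t) :
    intrinsicFrontier 𝕜 (s ×ˢ t) = intrinsicFrontier 𝕜 s ×ˢ t ∪ s ×ˢ intrinsicFrontier 𝕜 t := by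
  rw [intrinsicFrontier_eq_sdiff_of_isClosed hs, intrinsicFrontier_eq_sdiff_of_isClosed ht,
    intrinsicFrontier_eq_sdiff_of_isClosed (hs.prod ht), intrinsicInterior_prod_eq,
    prod_sdiff_prod, union_comm]

end IntrinsicInterior

theorem exists_one_lt_lineMap_mem_of_mem_intrinsicInterior {V : Type*} [AddCommGroup V]
    [Module ℝ V] [TopologicalSpace V] [IsTopologicalAddGroup V] [ContinuousSMul ℝ V] {s : Set V}
    {x y : V} (hx : x ∈ intrinsicInterior ℝ s) (hy : y ∈ s) :
    ∃ t : ℝ, 1 < t ∧ AffineMap.lineMap y x t ∈ s := by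
  obtain ⟨hxs, hs⟩ := mem_intrinsicInterior_iff_mem_nhdsWithin.1 hx
  have hlim : Filter.Tendsto (fun t : ℝ => AffineMap.lineMap y x t) (𝓝[>] 1)
      (𝓝[affineSpan ℝ s] x) := by
    refine tendsto_nhdsWithin_iff.2 ⟨?_, .of_forall fun t => AffineMap.lineMap_mem t
      (subset_affineSpan ℝ s hy) (subset_affineSpan ℝ s hxs)⟩
    have hcont : Continuous fun t : ℝ => AffineMap.lineMap y x t := by
      simp only [AffineMap.lineMap_apply_module]
      fun_prop
    simpa using (hcont.tendsto 1).mono_left nhdsWithin_le_nhds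
  exact ((eventually_mem_nhdsWithin (s := Ioi (1 : ℝ))).and (hlim hs)).exists

section Thickening

theorem exists_affineMap_retraction {K V P : Type*} [Field K] [AddCommGroup V] [Module K V]
    [AddTorsor V P] {S : AffineSubspace K P} (hS : (S : Set P).Nonempty) :
    ∃ ρ : P →ᵃ[K] P, (∀ x, ρ x ∈ S) ∧ ∀ x ∈ S, ρ x = x := by
  obtain ⟨p, hp⟩ := hS
  obtain ⟨π, hπ⟩ := S.direction.subtype.exists_leftInverse_of_injective S.direction.ker_subtype
  let e := AffineEquiv.vaddConst K p
  refine ⟨e.toAffineMap.comp ((S.direction.subtype ∘ₗ π).toAffineMap.comp e.symm.toAffineMap),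
    fun x => ?_, fun x hx => ?_⟩
  · exact AffineSubspace.vadd_mem_of_mem_direction (π (x -ᵥ p)).2 hp
  · have hfix := LinearMap.congr_fun hπ ⟨x -ᵥ p, AffineSubspace.vsub_mem_direction hx hp⟩
    simp only [LinearMap.comp_apply, Submodule.subtype_apply, LinearMap.id_apply] at hfix
    simp [e, hfix]

variable {V : Type*} [NormedAddCommGroup V] [NormedSpace ℝ V] [FiniteDimensional ℝ V] {P : Set V}

theorem exists_convex_isClosed_inter_affineSpan_eq (hP : Convex ℝ P) (hPc : IsClosed P)
    (hPne : P.Nonempty) :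
    ∃ T : Set V, Convex ℝ T ∧ IsClosed T ∧ T ∩ affineSpan ℝ P = P ∧
      interior T ∩ affineSpan ℝ P = intrinsicInterior ℝ P := by
  obtain ⟨ρ, hρmem, hρfix⟩ := exists_affineMap_retraction ((affineSpan_nonempty ℝ).2 hPne)
  have hρ : Continuous ρ := ρ.continuous_of_finiteDimensional
  have hinter : ρ ⁻¹' P ∩ affineSpan ℝ P = P := by
    refine Subset.antisymm (fun x hx => hρfix x hx.2 ▸ hx.1) fun x hx => ?_
    have hxS := subset_affineSpan ℝ P hx
    exact ⟨by rwa [mem_preimage, hρfix x hxS], hxS⟩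
  refine ⟨ρ ⁻¹' P, hP.affine_preimage ρ, hPc.preimage hρ, hinter, Subset.antisymm ?_ ?_⟩
  · exact fun x hx => mem_intrinsicInterior_of_inter_subset (subset_affineSpan ℝ P)
      isOpen_interior ((inter_subset_inter_left _ interior_subset).trans hinter.subset) hx.1 hx.2
  · intro x hx
    obtain ⟨hxP, hnhds⟩ := mem_intrinsicInterior_iff_mem_nhdsWithin.1 hx
    have hxS := subset_affineSpan ℝ P hxP
    have hlim : Filter.Tendsto ρ (𝓝 x) (𝓝[affineSpan ℝ P] x) :=
      tendsto_nhdsWithin_iff.2 ⟨by simpa [hρfix x hxS] using hρ.tendsto x, .of_forall hρmem⟩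
    exact ⟨mem_interior_iff_mem_nhds.2 (hlim hnhds), hxS⟩

end Thickening

section DeformationRetract

variable {E : Type*} [TopologicalSpace E]

theorem sdiff_interiorIn_eq_closure {B : Set E} (hB : IsClosed B) (Y : Set E) :
    B \ interiorIn B Y = closure (B \ Y) := by
  have hcl : closure (B \ Y) = Subtype.val '' closure ((Subtype.val ⁻¹' Y)ᶜ : Set B) := by
    rw [← hB.isClosedEmbedding_subtypeVal.closure_image_eq, ← preimage_compl,
      Subtype.image_preimage_coe, sdiff_eq]
  rw [hcl, closure_compl, image_compl_eq_range_sdiff_image Subtype.val_injective,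
    Subtype.range_coe]
  rfl

variable [AddCommGroup E] [Module ℝ E] [IsTopologicalAddGroup E] [ContinuousSMul ℝ E]

theorem isDeformationRetract_of_retraction {A X : Set E} (hX : Convex ℝ X) (hAX : A ⊆ X)
    {f : E → E} (hf : ContinuousOn f X) (hfA : MapsTo f X A) (hfix : ∀ a ∈ A, f a = a) :
    IsDeformationRetract A X := by
  refine ⟨hAX, ⟨fun z => ⟨AffineMap.lineMap (z.1 : E) (f z.1) (z.2 : ℝ),
    hX.lineMap_mem z.1.2 (hAX (hfA z.1.2)) z.2.2⟩, ?_⟩, fun x => ?_, fun x => ?_, fun x t hx => ?_⟩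
  · have hfX : Continuous fun z : X × unitInterval => f z.1 :=
      (continuousOn_iff_continuous_domRestrict.1 hf).comp continuous_fst
    simp only [AffineMap.lineMap_apply_module]
    have htime : Continuous fun z : X × unitInterval => (z.2 : ℝ) :=
      continuous_subtype_val.comp continuous_snd
    have hpoint : Continuous fun z : X × unitInterval => (z.1 : E) :=
      continuous_subtype_val.comp continuous_fst
    exact .subtype_mk (((continuous_const.sub htime).smul hpoint).add (htime.smul hfX)) _
  · ext1; simp
  · simpa using hfA x.2
  · ext1; simp [hfix _ hx]

end DeformationRetract

theorem preimage_add_left_mem_nhds_zero {M : Type*} [AddMonoid M] [TopologicalSpace M]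
    [ContinuousAdd M] {s : Set M} {c : M} (hc : c ∈ interior s) : (c + ·) ⁻¹' s ∈ 𝓝 (0 : M) :=
  (continuous_const_add c).continuousAt.preimage_mem_nhds
    (by simpa using mem_interior_iff_mem_nhds.1 hc)

section RadialExit

variable {E : Type*} [AddCommGroup E] [Module ℝ E] {Q : Set E} {c x : E}

/-- The Minkowski functional of `Q` with respect to the centre `c`. -/
noncomputable def gaugeAt (Q : Set E) (c x : E) : ℝ := gauge ((c + ·) ⁻¹' Q) (x - c)

/-- The point at which the ray from `c` through `x` leaves `Q`; if the ray stays in `Q` forever,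
this is the junk value `c`. -/
noncomputable def radialExit (Q : Set E) (c x : E) : E := AffineMap.lineMap c x (gaugeAt Q c x)⁻¹

theorem gaugeAt_nonneg : 0 ≤ gaugeAt Q c x := gauge_nonneg _

theorem gaugeAt_lineMap {r : ℝ} (hr : 0 ≤ r) :
    gaugeAt Q c (AffineMap.lineMap c x r) = r * gaugeAt Q c x := by
  simp [gaugeAt, AffineMap.lineMap_apply_module', gauge_smul_of_nonneg hr]

theorem gaugeAt_radialExit (hx : gaugeAt Q c x ≠ 0) : gaugeAt Q c (radialExit Q c x) = 1 := by
  rw [radialExit, gaugeAt_lineMap (inv_nonneg.2 gaugeAt_nonneg), inv_mul_cancel₀ hx]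

theorem radialExit_eq_self (hx : gaugeAt Q c x = 1) : radialExit Q c x = x := by
  simp [radialExit, hx]

variable [TopologicalSpace E] [IsTopologicalAddGroup E] [ContinuousSMul ℝ E]

theorem continuous_gaugeAt (hQ : Convex ℝ Q) (hc : c ∈ interior Q) : Continuous (gaugeAt Q c) :=
  (continuous_gauge (hQ.translate_preimage_right c) (preimage_add_left_mem_nhds_zero hc)).comp
    (continuous_sub_right c)

theorem gaugeAt_le_one_iff (hQ : Convex ℝ Q) (hQc : IsClosed Q) (hc : c ∈ interior Q) :
    gaugeAt Q c x ≤ 1 ↔ x ∈ Q := by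
  rw [gaugeAt, gauge_le_one_iff_mem_closure (hQ.translate_preimage_right c)
    (preimage_add_left_mem_nhds_zero hc), (hQc.preimage (continuous_const_add c)).closure_eq]
  simp

theorem gaugeAt_lt_one_iff (hQ : Convex ℝ Q) (hc : c ∈ interior Q) :
    gaugeAt Q c x < 1 ↔ x ∈ interior Q := by
  have hint : interior ((c + ·) ⁻¹' Q) = (c + ·) ⁻¹' interior Q :=
    ((Homeomorph.addLeft c).preimage_interior Q).symm
  rw [gaugeAt, gauge_lt_one_iff_mem_interior (hQ.translate_preimage_right c)
    (preimage_add_left_mem_nhds_zero hc), hint]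
  simp

theorem gaugeAt_eq_one_iff (hQ : Convex ℝ Q) (hQc : IsClosed Q) (hc : c ∈ interior Q) :
    gaugeAt Q c x = 1 ↔ x ∈ Q \ interior Q := by
  rw [eq_iff_le_not_lt, gaugeAt_le_one_iff hQ hQc hc, gaugeAt_lt_one_iff hQ hc, mem_sdiff]

theorem gaugeAt_ne_zero (hQ : Convex ℝ Q) (hQc : IsClosed Q) (hc : c ∈ interior Q) {r : ℝ}
    (hr : 0 ≤ r) (hxr : AffineMap.lineMap c x r ∉ Q) : gaugeAt Q c x ≠ 0 := fun h0 =>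
  hxr <| (gaugeAt_le_one_iff hQ hQc hc).1 <| by simp [gaugeAt_lineMap hr, h0]

theorem isDeformationRetract_sdiff_interior {X : Set E} (hX : Convex ℝ X) (hQ : Convex ℝ Q)
    (hQc : IsClosed Q) (hXQ : X ⊆ Q) (hc : c ∈ interior Q)
    (hleave : ∀ x ∈ X, ∃ r : ℝ, 0 ≤ r ∧ AffineMap.lineMap c x r ∉ Q)
    (hstay : ∀ x ∈ X, ∀ r : ℝ, 1 ≤ r → AffineMap.lineMap c x r ∈ Q → AffineMap.lineMap c x r ∈ X) :
    IsDeformationRetract (X \ interior Q) X := by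
  have hne : ∀ x ∈ X, gaugeAt Q c x ≠ 0 := fun x hx =>
    let ⟨_, hr, hxr⟩ := hleave x hx
    gaugeAt_ne_zero hQ hQc hc hr hxr
  refine isDeformationRetract_of_retraction hX sdiff_subset (f := radialExit Q c) ?_ ?_ ?_
  · have hinv : ContinuousOn (fun x => (gaugeAt Q c x)⁻¹) X :=
      (continuous_gaugeAt hQ hc).continuousOn.inv₀ hne
    unfold radialExit
    simp only [AffineMap.lineMap_apply_module']
    fun_prop
  · intro x hx
    obtain ⟨hexitQ, hexit⟩ := (gaugeAt_eq_one_iff hQ hQc hc).1 (gaugeAt_radialExit (hne x hx))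
    have hone : 1 ≤ (gaugeAt Q c x)⁻¹ := (one_le_inv₀ (gaugeAt_nonneg.lt_of_ne' (hne x hx))).2
      ((gaugeAt_le_one_iff hQ hQc hc).2 (hXQ hx))
    exact ⟨hstay x hx _ hone hexitQ, hexit⟩
  · exact fun x hx => radialExit_eq_self ((gaugeAt_eq_one_iff hQ hQc hc).2 ⟨hXQ hx.1, hx.2⟩)

end RadialExit

section FaceBarycenter

variable {ι : Type*} {I : Set ι} {i : ι}

/-- The barycentre of the face of the standard simplex spanned by the vertices in `I`. -/
noncomputable def faceBarycenter (I : Set ι) : ι → ℝ := I.indicator fun _ => (I.ncard : ℝ)⁻¹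

theorem faceBarycenter_nonneg : 0 ≤ faceBarycenter I i := indicator_nonneg (by simp) i

theorem faceBarycenter_of_notMem (hi : i ∉ I) : faceBarycenter I i = 0 :=
  indicator_of_notMem hi _

theorem faceBarycenter_compl_of_mem (hi : i ∈ I) : faceBarycenter Iᶜ i = 0 :=
  faceBarycenter_of_notMem (not_not_intro hi)

/-- The reflection of the barycentre of the face spanned by `I` in the barycentre of the opposite
face. It lies beyond the facets of the simplex indexed by `I`, and only beyond those. -/
noncomputable def outerCenter (I : Set ι) : ι → ℝ :=
  AffineMap.lineMap (faceBarycenter I) (faceBarycenter Iᶜ) (2 : ℝ)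

theorem outerCenter_apply :
    outerCenter I i = 2 * faceBarycenter Iᶜ i - faceBarycenter I i := by
  simp only [outerCenter, AffineMap.lineMap_apply_module, Pi.add_apply, Pi.smul_apply, smul_eq_mul]
  ring

theorem outerCenter_nonpos (hi : i ∈ I) : outerCenter I i ≤ 0 := by
  rw [outerCenter_apply, faceBarycenter_compl_of_mem hi]
  linarith [faceBarycenter_nonneg (I := I) (i := i)]

variable [Finite ι]

theorem faceBarycenter_pos (hi : i ∈ I) : 0 < faceBarycenter I i := by
  rw [faceBarycenter, indicator_of_mem hi]
  exact inv_pos.2 (mod_cast I.ncard_pos.2 ⟨i, hi⟩)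

theorem outerCenter_pos (hi : i ∉ I) : 0 < outerCenter I i := by
  rw [outerCenter_apply, faceBarycenter_of_notMem hi, sub_zero]
  exact mul_pos two_pos (faceBarycenter_pos hi)

end FaceBarycenter

section Simplex

variable {ι : Type*} [Fintype ι] {I : Set ι} {s w : ι → ℝ}

/-- The union of the facets of the standard simplex opposite to the vertices in `I`. -/
def facetUnion (I : Set ι) : Set (ι → ℝ) := {s | s ∈ stdSimplex ℝ ι ∧ ∃ i ∈ I, s i = 0}

theorem facetUnion_eq_biUnion (I : Set ι) :
    facetUnion I = ⋃ i ∈ I, stdSimplex ℝ ι ∩ {s | s i = 0} := by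
  ext s
  simp [facetUnion]

theorem isClosed_facetUnion (I : Set ι) : IsClosed (facetUnion I) := by
  rw [facetUnion_eq_biUnion]
  exact I.toFinite.isClosed_biUnion fun i _ =>
    (isClosed_stdSimplex ℝ ι).inter (isClosed_eq (continuous_apply i) continuous_const)

theorem stdSimplex_sdiff_pi_Ioi (I : Set ι) :
    stdSimplex ℝ ι \ I.pi (fun _ => Ioi 0) = facetUnion I := by
  ext s
  refine and_congr_right fun hs => ?_
  simp only [mem_pi, mem_Ioi, not_forall, exists_prop, not_lt]
  exact exists_congr fun i => and_congr_right fun _ => ⟨fun h => h.antisymm (hs.1 i), le_of_eq⟩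

theorem intrinsicInterior_stdSimplex :
    intrinsicInterior ℝ (stdSimplex ℝ ι) = stdSimplex ℝ ι ∩ univ.pi fun _ => Ioi 0 := by
  classical
  ext s
  refine ⟨fun hs => ⟨intrinsicInterior_subset hs, fun i _ => ?_⟩, fun ⟨hs, hpos⟩ => ?_⟩
  · obtain ⟨t, ht, hmem⟩ :=
      exists_one_lt_lineMap_mem_of_mem_intrinsicInterior hs (single_mem_stdSimplex ℝ i)
    have hcoord : 0 ≤ (1 - t) + t * s i := by
      simpa [AffineMap.lineMap_apply_module] using hmem.1 i
    exact pos_of_mul_pos_right (by linarith) (zero_le_one.trans ht.le)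
  · let S : AffineSubspace ℝ (ι → ℝ) :=
      (AffineSubspace.mk' (1 : ℝ) ⊥).comap (∑ i, LinearMap.proj i : (ι → ℝ) →ₗ[ℝ] ℝ).toAffineMap
    have hS : ∀ y, y ∈ S ↔ ∑ i, y i = 1 := fun y => by simp [S, sub_eq_zero]
    exact mem_intrinsicInterior_of_inter_subset (S := S) (fun y hy => (hS y).2 hy.2)
      (isOpen_set_pi finite_univ fun _ _ => isOpen_Ioi)
      (fun y hy => ⟨fun i => (hy.1 i trivial).le, (hS y).1 hy.2⟩) hpos ((hS s).2 hs.2)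

theorem intrinsicFrontier_stdSimplex :
    intrinsicFrontier ℝ (stdSimplex ℝ ι) = facetUnion univ := by
  rw [intrinsicFrontier_eq_sdiff_of_isClosed (isClosed_stdSimplex ℝ ι),
    intrinsicInterior_stdSimplex, sdiff_self_inter, stdSimplex_sdiff_pi_Ioi]

theorem mem_closure_setOf_zeros_eq_inter (hs : s ∈ stdSimplex ℝ ι) (hw : w ∈ stdSimplex ℝ ι) :
    s ∈ closure {y | y ∈ stdSimplex ℝ ι ∧ ∀ i, y i = 0 ↔ s i = 0 ∧ w i = 0} := by
  refine closure_mono ?_ (segment_subset_closure_openSegment (left_mem_segment ℝ s w))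
  intro y hy
  refine ⟨(convex_stdSimplex ℝ ι).openSegment_subset hs hw hy, fun i => ?_⟩
  obtain ⟨a, b, ha, hb, -, rfl⟩ := hy
  simp [add_eq_zero_iff_of_nonneg (mul_nonneg ha.le (hs.1 i)) (mul_nonneg hb.le (hw.1 i)),
    ha.ne', hb.ne']

theorem sum_faceBarycenter (hI : I.Nonempty) : ∑ i, faceBarycenter I i = 1 := by
  classical
  have hcard : (I.ncard : ℝ) ≠ 0 := mod_cast (I.ncard_pos.2 hI).ne'
  simp only [faceBarycenter, indicator_apply, ← Finset.sum_filter, filter_mem_univ_eq_toFinset,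
    Finset.sum_const, nsmul_eq_mul, ← ncard_eq_toFinset_card']
  exact mul_inv_cancel₀ hcard

theorem faceBarycenter_mem_stdSimplex (hI : I.Nonempty) : faceBarycenter I ∈ stdSimplex ℝ ι :=
  ⟨fun _ => faceBarycenter_nonneg, sum_faceBarycenter hI⟩

theorem sum_outerCenter (hI : I.Nonempty) (hIc : Iᶜ.Nonempty) : ∑ i, outerCenter I i = 1 := by
  simp only [outerCenter_apply, Finset.sum_sub_distrib, ← Finset.mul_sum, sum_faceBarycenter, hI,
    hIc]
  norm_num

theorem exists_lt_outerCenter (hIc : Iᶜ.Nonempty) (hs : s ∈ stdSimplex ℝ ι) :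
    ∃ i ∉ I, s i < outerCenter I i := by
  by_contra! hle
  have hle' : ∀ i, 2 * faceBarycenter Iᶜ i ≤ s i := fun i => by
    by_cases hi : i ∈ I
    · simpa [faceBarycenter_compl_of_mem hi] using hs.1 i
    · simpa [outerCenter_apply, faceBarycenter_of_notMem hi] using hle i hi
  have hsum := Finset.sum_le_sum fun i (_ : i ∈ Finset.univ) => hle' i
  rw [← Finset.mul_sum, sum_faceBarycenter hIc, hs.2] at hsum
  linarith

theorem exists_lineMap_outerCenter_neg (hIc : Iᶜ.Nonempty) (hs : s ∈ stdSimplex ℝ ι) :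
    ∃ r : ℝ, 0 ≤ r ∧ ∃ i ∉ I, AffineMap.lineMap (outerCenter I) s r i < 0 := by
  obtain ⟨i, hi, hlt⟩ := exists_lt_outerCenter hIc hs
  have hgap := sub_pos.2 hlt
  refine ⟨(outerCenter I i + 1) / (outerCenter I i - s i),
    div_nonneg (by linarith [outerCenter_pos hi]) hgap.le, i, hi, ?_⟩
  have hcoord : AffineMap.lineMap (outerCenter I) s
      ((outerCenter I i + 1) / (outerCenter I i - s i)) i = -1 := by
    simp only [AffineMap.lineMap_apply_module', Pi.add_apply, Pi.smul_apply, Pi.sub_apply,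
      smul_eq_mul]
    field_simp
    ring
  linarith

theorem lineMap_outerCenter_mem_stdSimplex (hI : I.Nonempty) (hIc : Iᶜ.Nonempty)
    (hs : s ∈ stdSimplex ℝ ι) {r : ℝ} (hr : 1 ≤ r)
    (hpos : ∀ i ∉ I, 0 ≤ AffineMap.lineMap (outerCenter I) s r i) :
    AffineMap.lineMap (outerCenter I) s r ∈ stdSimplex ℝ ι := by
  refine ⟨fun i => ?_, ?_⟩
  · by_cases hi : i ∈ I
    · have hcenter := mul_nonneg_of_nonpos_of_nonpos (sub_nonpos.2 hr) (outerCenter_nonpos hi)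
      have hcoord := mul_nonneg (zero_le_one.trans hr) (hs.1 i)
      simpa [AffineMap.lineMap_apply_module] using add_nonneg hcenter hcoord
    · exact hpos i hi
  · simp [AffineMap.lineMap_apply_module, Finset.sum_add_distrib, ← Finset.mul_sum,
      sum_outerCenter hI hIc, hs.2]

theorem simplexFacet_eq (k : ℕ) (i : Fin (k + 1)) :
    simplexFacet k i = stdSimplex ℝ (Fin (k + 1)) ∩ {s | s i = 0} := by
  refine Subset.antisymm (convexHull_min ?_ ?_) ?_
  · rintro _ ⟨j, hj, rfl⟩
    exact ⟨single_mem_stdSimplex ℝ j, Pi.single_eq_of_ne (Ne.symm hj) 1⟩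
  · exact (convex_stdSimplex ℝ _).inter
      (convex_hyperplane (LinearMap.proj (R := ℝ) i).isLinear 0)
  · rintro s ⟨hs, hsi⟩
    have hsum : s = ∑ j ∈ Finset.univ.erase i, s j • (Pi.single j 1 : Fin (k + 1) → ℝ) := by
      rw [Finset.sum_erase _ (by simp [hsi.out]), ← pi_eq_sum_univ' s]
    rw [hsum]
    refine (convex_convexHull ℝ _).sum_mem (fun j _ => hs.1 j) ?_ fun j hj => ?_
    · rw [Finset.sum_erase _ hsi, hs.2]
    · exact subset_convexHull ℝ _ ⟨j, Finset.ne_of_mem_erase hj, rfl⟩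

end Simplex

section ProductWithSimplex

variable {V ι : Type*} [NormedAddCommGroup V] [NormedSpace ℝ V] [FiniteDimensional ℝ V]
  [Fintype ι] {P : Set V} {I : Set ι}

theorem closure_intrinsicFrontier_prod_stdSimplex_sdiff (hPc : IsClosed P) (hI : I.Nonempty) :
    closure (intrinsicFrontier ℝ (P ×ˢ stdSimplex ℝ ι) \ P ×ˢ facetUnion I) =
      intrinsicFrontier ℝ P ×ˢ stdSimplex ℝ ι ∪ P ×ˢ facetUnion Iᶜ := by
  rw [intrinsicFrontier_prod_of_isClosed hPc (isClosed_stdSimplex ℝ ι),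
    intrinsicFrontier_stdSimplex]
  refine Subset.antisymm (closure_minimal ?_ ?_) ?_
  · rintro ⟨v, s⟩ ⟨hv | ⟨hv, hs, i, -, hi⟩, hY⟩
    · exact .inl hv
    · exact .inr ⟨hv, hs, i, fun hiI => hY ⟨hv, hs, i, hiI, hi⟩, hi⟩
  · exact ((isClosed_intrinsicFrontier (AffineSubspace.closed_of_finiteDimensional _)).prod
      (isClosed_stdSimplex ℝ ι)).union (hPc.prod (isClosed_facetUnion _))
  · rintro ⟨v, s⟩ hvs
    have hs : s ∈ stdSimplex ℝ ι := hvs.elim (fun h => h.2) fun h => h.2.1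
    refine map_mem_closure (Continuous.prodMk_right v)
      (mem_closure_setOf_zeros_eq_inter hs (faceBarycenter_mem_stdSimplex hI)) ?_
    refine fun y ⟨hy, hzero⟩ =>
      ⟨?_, fun ⟨_, _, i, hi, hyi⟩ => (faceBarycenter_pos hi).ne' ((hzero i).1 hyi).2⟩
    rcases hvs with ⟨hv, -⟩ | ⟨hv, -, i, hi, hsi⟩
    · exact .inl ⟨hv, hy⟩
    · exact .inr ⟨hv, hy, i, trivial, (hzero i).2 ⟨hsi, faceBarycenter_of_notMem hi⟩⟩

theorem intrinsicFrontier_sdiff_interiorIn (hPc : IsClosed P) (hI : I.Nonempty) :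
    intrinsicFrontier ℝ (P ×ˢ stdSimplex ℝ ι) \
        interiorIn (intrinsicFrontier ℝ (P ×ˢ stdSimplex ℝ ι)) (P ×ˢ facetUnion I) =
      intrinsicFrontier ℝ P ×ˢ stdSimplex ℝ ι ∪ P ×ˢ facetUnion Iᶜ := by
  rw [sdiff_interiorIn_eq_closure
    (isClosed_intrinsicFrontier (AffineSubspace.closed_of_finiteDimensional _)),
    closure_intrinsicFrontier_prod_stdSimplex_sdiff hPc hI]

theorem isDeformationRetract_prod_stdSimplex (hP : Convex ℝ P) (hPc : IsClosed P)
    (hPne : P.Nonempty) (hI : I.Nonempty) (hIc : Iᶜ.Nonempty) :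
    IsDeformationRetract (intrinsicFrontier ℝ P ×ˢ stdSimplex ℝ ι ∪ P ×ˢ facetUnion Iᶜ)
      (P ×ˢ stdSimplex ℝ ι) := by
  obtain ⟨T, hT, hTc, hTP, hTint⟩ := exists_convex_isClosed_inter_affineSpan_eq hP hPc hPne
  obtain ⟨p, hp⟩ := hPne.intrinsicInterior hP
  have hpP := intrinsicInterior_subset hp
  let Q : Set (V × (ι → ℝ)) := T ×ˢ Iᶜ.pi fun _ => Ici 0
  have hQint : interior Q = interior T ×ˢ Iᶜ.pi fun _ => Ioi 0 := by
    simp [Q, interior_prod_eq, interior_pi_set (toFinite Iᶜ)]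
  have hPT : P \ interior T = intrinsicFrontier ℝ P := by
    rw [intrinsicFrontier_eq_sdiff_of_isClosed hPc, ← hTint, sdiff_inter,
      sdiff_eq_empty.2 (subset_affineSpan ℝ P), union_empty]
  have hexit : P ×ˢ stdSimplex ℝ ι \ interior Q =
      intrinsicFrontier ℝ P ×ˢ stdSimplex ℝ ι ∪ P ×ˢ facetUnion Iᶜ := by
    rw [hQint, prod_sdiff_prod, hPT, stdSimplex_sdiff_pi_Ioi, union_comm]
  rw [← hexit]
  refine isDeformationRetract_sdiff_interior (c := (p, outerCenter I))
    (hP.prod (convex_stdSimplex ℝ ι)) (hT.prod (convex_pi fun _ _ => convex_Ici 0))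
    (hTc.prod (isClosed_set_pi fun _ _ => isClosed_Ici)) ?_ ?_ ?_ ?_
  · exact fun x hx => ⟨(hTP.superset hx.1).1, fun i _ => hx.2.1 i⟩
  · exact hQint ▸ ⟨(hTint.superset hp).1, fun i hi => outerCenter_pos hi⟩
  · intro x hx
    obtain ⟨r, hr, i, hi, hneg⟩ := exists_lineMap_outerCenter_neg hIc hx.2
    exact ⟨r, hr, fun hmem => hneg.not_ge (by simpa using hmem.2 i hi)⟩
  · intro x hx r hr hmem
    have hspan : AffineMap.lineMap p x.1 r ∈ affineSpan ℝ P :=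
      AffineMap.lineMap_mem r (subset_affineSpan ℝ P hpP) (subset_affineSpan ℝ P hx.1)
    refine ⟨hTP.subset ⟨hmem.1, by simpa using hspan⟩, ?_⟩
    simpa using lineMap_outerCenter_mem_stdSimplex hI hIc hx.2 hr
      fun i hi => by simpa using hmem.2 i hi

theorem mainTheorem7_general {k : ℕ} {I : Set (Fin (k + 1))} (hP : Convex ℝ P) (hPc : IsClosed P)
    (hPne : P.Nonempty) (hI : I.Nonempty) (hIc : Iᶜ.Nonempty) :
    IsDeformationRetract
      (intrinsicFrontier ℝ (P ×ˢ stdSimplex ℝ (Fin (k + 1))) \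
        interiorIn (intrinsicFrontier ℝ (P ×ˢ stdSimplex ℝ (Fin (k + 1))))
          (P ×ˢ ⋃ i ∈ I, simplexFacet k i))
      (P ×ˢ stdSimplex ℝ (Fin (k + 1))) := by
  simp only [simplexFacet_eq, ← facetUnion_eq_biUnion]
  rw [intrinsicFrontier_sdiff_interiorIn hPc hI]
  exact isDeformationRetract_prod_stdSimplex hP hPc hPne hI hIc

end ProductWithSimplex

theorem isCompact_permutohedron (n : ℕ) : IsCompact (permutohedron n) :=
  (finite_range _).isCompact_convexHull ℝ

theorem permutohedron_nonempty (n : ℕ) : (permutohedron n).Nonempty :=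
  (range_nonempty _).convexHull

theorem mainTheorem7 (n k : ℕ) (hn : 3 ≤ n) (hk : 2 ≤ k) (m : Fin k → ℕ)
    (hm : ∀ l, 1 ≤ m l) (hsum : ∑ l, m l = n - 1) :
    IsDeformationRetract
      (polytopeBoundary (productCell m) \
        interiorIn (polytopeBoundary (productCell m)) (gluedPart m))
      (productCell m) := by
  have hinner : {i : Fin (k + 1) | i ≠ 0 ∧ i ≠ Fin.last k}.Nonempty :=
    ⟨⟨1, by lia⟩, by simp [Fin.ext_iff], by simp only [ne_eq, Fin.ext_iff, Fin.val_last]; lia⟩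
  have houter : {i : Fin (k + 1) | i ≠ 0 ∧ i ≠ Fin.last k}ᶜ.Nonempty := ⟨0, by simp⟩
  exact mainTheorem7_general (convex_pi fun _ _ => convex_convexHull ℝ _)
    (isClosed_set_pi fun l _ => (isCompact_permutohedron (m l)).isClosed)
    (univ_pi_nonempty_iff.2 fun l => permutohedron_nonempty (m l)) hinner houter
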